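/- Corollary (graded Wedderburn–Mal'cev theorem). Let $F$ be a field, let $G$ be an arbitrary group, and let $A=\bigoplus_{g\in G}A^{(g)}$ be a finite dimensional associative (not necessarily unital) $F$-algebra graded by $G$, i.e. the $A^{(g)}$ are subspaces with $A^{(g)}A^{(h)}\subseteq A^{(gh)}$ for all $g,h\in G$. Suppose that either $\operatorname{char} F=0$ or $\operatorname{char}F>\dim_F A$, and that $A/J(A)$ is a separable $F$-algebra, where $J(A)$ is the Jacobson radical of $A$. (An $F$-algebra $C$ is separable if it has an identity element and there is $e\in C\otimes_F C$ such that $(c\otimes 1)e=e(1\otimes c)$ for all $c\in C$ (where $c$ acts on the first tensor factor from the left and on the second from the right) and the multiplication map $C\otimes_F C\to C$ sends $e$ to $1$.) Then there exists a subalgebra $B\subseteq A$ that is maximal, with respect to inclusion, among all semisimple subalgebras of $A$ (subalgebras whose Jacobson radical is zero), such that $A=B\oplus J(A)$ as vector spaces and both $B$ and $J(A)$ are graded subspaces, where a subspace $V\subseteq A$ is graded if $V=\bigoplus_{g\in G}(V\cap A^{(g)})$. -/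

import Mathlib

open scoped TensorProduct

noncomputable section

namespace GradedWM

/-! Associative algebras are not assumed to have an identity element: such an algebra over a
field `F` is a type `A` with `[NonUnitalRing A] [Module F A] [IsScalarTower F A A]
[SMulCommClass F A A]`. Recall that `IsQuasiregular x` means that there is `y` with
`x + y + x * y = 0 = y + x + y * x` (if there is an identity: that `1 + x` is invertible). -/

/-- Sums: if `x` and `y` generate quasi-regular left ideals, so does `x + y`. -/
theorem isQuasiregular_mul_add {A : Type*} [NonUnitalRing A] {x y : A}
    (hx : ∀ a, IsQuasiregular (a * x)) (hy : ∀ a, IsQuasiregular (a * y)) (a : A) :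
    IsQuasiregular (a * (x + y)) := by
  obtain ⟨c, hc1, hc2⟩ := isQuasiregular_iff.mp (hx a)
  have h1 := isQuasiregular_iff'.mp (hx a)
  have h2 := isQuasiregular_iff'.mp (hy (a + c * a))
  have h3 := h1.mul h2
  rw [isQuasiregular_iff']
  convert h3 using 1
  apply PreQuasiregular.equiv.symm.injective
  rw [PreQuasiregular.equiv_symm_apply, PreQuasiregular.equiv_symm_apply]
  simp only [PreQuasiregular.val_mul, PreQuasiregular.equiv_apply_val]
  have e : c * (a * y) + a * x * (a * y) + a * x * (c * (a * y)) = 0 := by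
    have := congrArg (· * (a * y)) hc1
    simpa [add_mul, mul_assoc] using this
  have e' : (a + c * a) * y + a * x + a * x * ((a + c * a) * y)
      = a * (x + y) + (c * (a * y) + a * x * (a * y) + a * x * (c * (a * y))) := by
    noncomm_ring
  rw [e', e, add_zero]

/-- `u * v` is quasi-regular iff `v * u` is; one direction. -/
theorem isQuasiregular_mul_swap {A : Type*} [NonUnitalRing A] {u v : A}
    (h : IsQuasiregular (u * v)) : IsQuasiregular (v * u) := by
  obtain ⟨c, hc1, hc2⟩ := isQuasiregular_iff.mp h
  refine isQuasiregular_iff.mpr ⟨-(v * u) - v * c * u, ?_, ?_⟩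
  · have e : -(v * u) - v * c * u + v * u + v * u * (-(v * u) - v * c * u)
        = -(v * (c + u * v + u * v * c) * u) := by noncomm_ring
    rw [e, hc1]; simp
  · have e : v * u + (-(v * u) - v * c * u) + (-(v * u) - v * c * u) * (v * u)
        = -(v * (u * v + c + c * (u * v)) * u) := by noncomm_ring
    rw [e, hc2]; simp

section

variable (F : Type*) [Field F] (A : Type*) [NonUnitalRing A] [Module F A]
  [IsScalarTower F A A] [SMulCommClass F A A]

/-- The Jacobson radical `J(A)` of a not necessarily unital algebra: the set of all `x` such that
every element of `A x` is quasi-regular. -/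
def jacobsonRadical : Submodule F A where
  carrier := {x | ∀ a : A, IsQuasiregular (a * x)}
  zero_mem' a := by rw [mul_zero]; exact ⟨1, rfl⟩
  add_mem' hx hy := isQuasiregular_mul_add hx hy
  smul_mem' r x hx a := by
    have h := hx (r • a)
    rwa [smul_mul_assoc, ← mul_smul_comm] at h

variable {F A} in
theorem mem_jacobsonRadical {x : A} :
    x ∈ jacobsonRadical F A ↔ ∀ a : A, IsQuasiregular (a * x) := Iff.rfl

variable {F A} in
theorem mul_mem_jacobsonRadical_left (a : A) {x : A} (hx : x ∈ jacobsonRadical F A) :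
    a * x ∈ jacobsonRadical F A := fun b => by
  rw [← mul_assoc]; exact hx (b * a)

variable {F A} in
theorem mul_mem_jacobsonRadical_right (a : A) {x : A} (hx : x ∈ jacobsonRadical F A) :
    x * a ∈ jacobsonRadical F A := fun b => by
  rw [← mul_assoc]
  apply isQuasiregular_mul_swap
  rw [← mul_assoc]; exact hx (a * b)

/-- The quotient algebra `A / J(A)`. -/
def JacobsonQuotient : Type _ := A ⧸ jacobsonRadical F A

namespace JacobsonQuotient

instance : AddCommGroup (JacobsonQuotient F A) :=
  inferInstanceAs (AddCommGroup (A ⧸ jacobsonRadical F A))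

instance : Module F (JacobsonQuotient F A) :=
  inferInstanceAs (Module F (A ⧸ jacobsonRadical F A))

/-- The canonical projection `A → A / J(A)`. -/
def mk : A →ₗ[F] JacobsonQuotient F A := (jacobsonRadical F A).mkQ

theorem mk_surjective : Function.Surjective (mk F A) := (jacobsonRadical F A).mkQ_surjective

theorem mk_eq_mk {x y : A} : mk F A x = mk F A y ↔ x - y ∈ jacobsonRadical F A :=
  Submodule.Quotient.eq _

instance : Mul (JacobsonQuotient F A) where
  mul := Quotient.map₂ (fun a b : A => a * b) (by
    intro a a' ha b b' hb
    rw [← Quotient.eq_iff_equiv] at ha hb ⊢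
    have ha' : a - a' ∈ jacobsonRadical F A := (mk_eq_mk F A).mp ha
    have hb' : b - b' ∈ jacobsonRadical F A := (mk_eq_mk F A).mp hb
    refine (mk_eq_mk F A).mpr ?_
    have e : a * b - a' * b' = a * (b - b') + (a - a') * b' := by noncomm_ring
    rw [e]
    exact add_mem (mul_mem_jacobsonRadical_left a hb') (mul_mem_jacobsonRadical_right b' ha'))

theorem mk_mul (a b : A) : mk F A (a * b) = mk F A a * mk F A b := rfl

instance : NonUnitalRing (JacobsonQuotient F A) :=
  { (inferInstance : AddCommGroup (JacobsonQuotient F A)),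
    (inferInstance : Mul (JacobsonQuotient F A)) with
    left_distrib := fun x y z => by
      obtain ⟨x, rfl⟩ := mk_surjective F A x
      obtain ⟨y, rfl⟩ := mk_surjective F A y
      obtain ⟨z, rfl⟩ := mk_surjective F A z
      rw [← map_add, ← mk_mul, ← mk_mul, ← mk_mul, ← map_add, mul_add]
    right_distrib := fun x y z => by
      obtain ⟨x, rfl⟩ := mk_surjective F A x
      obtain ⟨y, rfl⟩ := mk_surjective F A y
      obtain ⟨z, rfl⟩ := mk_surjective F A z
      rw [← map_add, ← mk_mul, ← mk_mul, ← mk_mul, ← map_add, add_mul]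
    zero_mul := fun x => by
      obtain ⟨x, rfl⟩ := mk_surjective F A x
      rw [← map_zero (mk F A), ← mk_mul, zero_mul]
    mul_zero := fun x => by
      obtain ⟨x, rfl⟩ := mk_surjective F A x
      rw [← map_zero (mk F A), ← mk_mul, mul_zero]
    mul_assoc := fun x y z => by
      obtain ⟨x, rfl⟩ := mk_surjective F A x
      obtain ⟨y, rfl⟩ := mk_surjective F A y
      obtain ⟨z, rfl⟩ := mk_surjective F A z
      rw [← mk_mul, ← mk_mul, ← mk_mul, ← mk_mul, mul_assoc] }

instance : IsScalarTower F (JacobsonQuotient F A) (JacobsonQuotient F A) where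
  smul_assoc r x y := by
    obtain ⟨x, rfl⟩ := mk_surjective F A x
    obtain ⟨y, rfl⟩ := mk_surjective F A y
    rw [smul_eq_mul, smul_eq_mul, ← map_smul, ← mk_mul, ← mk_mul, ← map_smul, smul_mul_assoc]

instance : SMulCommClass F (JacobsonQuotient F A) (JacobsonQuotient F A) where
  smul_comm r x y := by
    obtain ⟨x, rfl⟩ := mk_surjective F A x
    obtain ⟨y, rfl⟩ := mk_surjective F A y
    rw [smul_eq_mul, smul_eq_mul, ← map_smul, ← mk_mul, ← mk_mul, ← map_smul, mul_smul_comm]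

end JacobsonQuotient

/-- A finite dimensional algebra is semisimple if its Jacobson radical is zero. -/
def IsSemisimpleAlgebra : Prop := jacobsonRadical F A = ⊥

/-- `A` is a separable algebra over `F`: there is `e = ∑ xᵢ ⊗ yᵢ` in `A ⊗ A` with
`∑ (a xᵢ) ⊗ yᵢ = ∑ xᵢ ⊗ (yᵢ a)` for all `a`, and `∑ xᵢ yᵢ` is an identity element of `A`
(so `A` has an identity element and `e` is a separability idempotent). -/
def IsSeparableAlgebra : Prop :=
  ∃ e : A ⊗[F] A,
    (∀ a : A, TensorProduct.map (LinearMap.mulLeft F a) LinearMap.id e =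
      TensorProduct.map LinearMap.id (LinearMap.mulRight F a) e) ∧
    ∀ a : A, LinearMap.mul' F A e * a = a ∧ a * LinearMap.mul' F A e = a

end

section

variable {F : Type*} [Field F] {A : Type*} [NonUnitalRing A] [Module F A] {G : Type*}

/-- `A = ⨁ g, 𝒜 g` is a grading of the algebra `A` by the group `G`. -/
structure IsGroupGrading [Group G] [DecidableEq G] (𝒜 : G → Submodule F A) : Prop where
  isInternal : DirectSum.IsInternal 𝒜
  mul_mem : ∀ {g h : G} {a b : A}, a ∈ 𝒜 g → b ∈ 𝒜 h → a * b ∈ 𝒜 (g * h)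

/-- The subspace `V` is graded: it is the sum of its intersections with the components. -/
def IsGradedSubspace (𝒜 : G → Submodule F A) (V : Submodule F A) : Prop :=
  V = ⨆ g, V ⊓ 𝒜 g

end

end GradedWM

end

noncomputable section

set_option linter.unusedSectionVars false

/-! The hypothesis on the characteristic serves only to make `J(A)` graded. Let `L_c` be left
multiplication by `c`. Then `J(A)` is the radical of the form `(a, x) ↦ tr L_{ax}`: elements of
`J(A)` are nilpotent, and conversely, if the form kills `x`, all positive powers of `L_{ax}` have
trace zero, which forces nilpotency in these characteristics (`mem_jacobsonRadical_iff_trace`). If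
`c` is homogeneous of degree `≠ 1`, `L_c` sends every component into a different one and has trace
zero. So the form pairs degree `h` only with degree `h⁻¹`, and its radical is graded
(`proj_mem_jacobsonRadical`).

Hence `C = A / J(A)` is graded, and the degree-one part of a separability element of `C` is again
one (`exists_separabilityElement_degreeOne`). Start from a degree-preserving linear section `s` of
`A → C`. Contracting its defect `s a * s b - s (a * b)` with that element yields a degree-preserving
correction whose defect lies twice as deep in a nilpotent filtration (`corrected_mul_sub_mem`). This
Newton iteration ends in a multiplicative section, whose range is `B`. A subalgebra complementary to
`J(A)` is automatically maximal semisimple (`maximal_isSemisimpleAlgebra_of_isCompl`). -/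

namespace GradedWM

/-! ### Nilpotency of the radical and its description by traces. -/

section Nilpotency

/-- An endomorphism all of whose positive powers have trace zero is nilpotent, if the
characteristic is zero or exceeds the dimension. -/
theorem isNilpotent_of_forall_trace_pow_eq_zero {F V : Type*} [Field F] [AddCommGroup V]
    [Module F V] [FiniteDimensional F V]
    (hchar : ringChar F = 0 ∨ Module.finrank F V < ringChar F) (T : Module.End F V)
    (hT : ∀ n, LinearMap.trace F V (T ^ (n + 1)) = 0) : IsNilpotent T := by
  have hne : minpoly F T ≠ 0 := minpoly.ne_zero_of_finite F T
  obtain ⟨r, hr, hdvd⟩ := Polynomial.exists_eq_pow_rootMultiplicity_mul_and_not_dvd _ hne 0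
  set k := Polynomial.rootMultiplicity 0 (minpoly F T)
  rw [Polynomial.C_0, sub_zero] at hr hdvd
  have hcop : IsCoprime ((Polynomial.X : Polynomial F) ^ (k + 1)) r :=
    ((Polynomial.prime_X.irreducible.coprime_iff_not_dvd).mpr hdvd).pow_left
  obtain ⟨a, b, hab⟩ := hcop
  have hmin : Polynomial.aeval T (Polynomial.X ^ k * r) = 0 := by
    rw [← hr]; exact minpoly.aeval F T
  -- Fitting decomposition: `E` projects onto the part where `T` is invertible. Its trace is its
  -- rank in `F`, but also zero, as `E` is a polynomial in `T` without constant term.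
  set E := Polynomial.aeval T (a * Polynomial.X ^ (k + 1)) with hE
  have hidem : IsIdempotentElem E := by
    have h : a * Polynomial.X ^ (k + 1) * (a * Polynomial.X ^ (k + 1))
        = a * Polynomial.X ^ (k + 1) - (a * Polynomial.X * b) * (Polynomial.X ^ k * r) := by
      linear_combination (a * Polynomial.X ^ (k + 1)) * hab
    change E * E = E
    rw [hE, ← map_mul, h, map_sub, map_mul _ _ (Polynomial.X ^ k * r), hmin, mul_zero, sub_zero]
  have htr : LinearMap.trace F V E = 0 := by
    have h : ∀ q : Polynomial F,
        LinearMap.trace F V (Polynomial.aeval T (q * Polynomial.X ^ (k + 1))) = 0 := by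
      intro q
      induction q using Polynomial.induction_on' with
      | add p q hp hq => rw [add_mul, map_add, map_add, hp, hq, add_zero]
      | monomial n c =>
        rw [← Polynomial.C_mul_X_pow_eq_monomial, mul_assoc, ← pow_add, ← Polynomial.smul_eq_C_mul,
          map_smul, map_smul, map_pow, Polynomial.aeval_X, ← add_assoc, hT, smul_zero]
    exact h a
  have hE0 : E = 0 := by
    rw [(LinearMap.IsIdempotentElem.isProj_range E hidem).trace,
      ringChar.spec] at htr
    have hle := Submodule.finrank_le (LinearMap.range E)
    have h0 : Module.finrank F (LinearMap.range E) = 0 := by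
      rcases hchar with h | h
      · rw [h] at htr; exact Nat.eq_zero_of_zero_dvd htr
      · exact Nat.eq_zero_of_dvd_of_lt htr (hle.trans_lt h)
    exact LinearMap.range_eq_bot.mp (Submodule.finrank_eq_zero.mp h0)
  refine ⟨k, ?_⟩
  have h := congrArg (fun p => Polynomial.aeval T (Polynomial.X ^ k * p)) hab
  simp only [mul_add, map_add, mul_one] at h
  rw [map_mul _ _ (a * _), ← hE, hE0, mul_zero, zero_add, mul_left_comm, map_mul _ b, hmin,
    mul_zero, map_pow, Polynomial.aeval_X] at h
  exact h.symm

variable {F : Type*} [Field F] {A : Type*} [NonUnitalRing A] [Module F A]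
  [IsScalarTower F A A] [SMulCommClass F A A]

theorem isQuasiregular_of_mem_jacobsonRadical {x : A} (hx : x ∈ jacobsonRadical F A) :
    IsQuasiregular x := by
  -- `1 - x ^ 2` is a unit with commuting factors `1 + x` and `1 - x`.
  have h := hx (-x)
  rw [isQuasiregular_iff_isUnit' F] at h ⊢
  have hc : Commute (1 + (x : Unitization F A)) (1 - (x : Unitization F A)) := by
    rw [commute_iff_eq]; noncomm_ring
  refine (hc.isUnit_mul_iff.mp ?_).1
  convert h using 1
  simp only [Unitization.inr_mul, Unitization.inr_neg]
  noncomm_ring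

instance finiteDimensional_unitization [FiniteDimensional F A] :
    FiniteDimensional F (Unitization F A) :=
  Module.Finite.of_surjective
    (LinearMap.coprod (Algebra.linearMap F (Unitization F A)) (Unitization.inrHom F F A)) (by
      intro x
      induction x with
      | inl_add_inr r a => exact ⟨(r, a), by simp [Unitization.algebraMap_eq_inl]⟩)

/-- Passing to the unitization gives access to the nilpotency of the radical of a unital Artinian
ring. -/
theorem inr_mem_jacobson {x : A} (hx : x ∈ jacobsonRadical F A) :
    (x : Unitization F A) ∈ Ring.jacobson (Unitization F A) := by
  rw [← Ideal.jacobson_bot, Ideal.mem_jacobson_iff]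
  intro y
  induction y with
  | inl_add_inr r a =>
    have hw : r • x + a * x ∈ jacobsonRadical F A :=
      add_mem (Submodule.smul_mem _ r hx) (mul_mem_jacobsonRadical_left a hx)
    obtain ⟨u, hu⟩ := (isQuasiregular_iff_isUnit' F).mp (isQuasiregular_of_mem_jacobsonRadical hw)
    refine ⟨((u⁻¹ : (Unitization F A)ˣ) : Unitization F A), ?_⟩
    have h : (Unitization.inl r + (a : Unitization F A)) * (x : Unitization F A)
        = (u : Unitization F A) - 1 := by
      rw [hu, add_mul, Unitization.inl_mul_inr]; simp
    rw [mul_assoc, h, mul_sub, Units.inv_mul]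
    simp

variable (F A) in
/-- The Jacobson radical of a finite dimensional algebra lies in the first term of a finite
multiplicative filtration. -/
theorem exists_filtration [FiniteDimensional F A] :
    ∃ I : ℕ → Submodule F A, I 0 = ⊤ ∧ jacobsonRadical F A ≤ I 1 ∧
      (∀ m n a b, a ∈ I m → b ∈ I n → a * b ∈ I (m + n)) ∧ ∃ N, ∀ n, N ≤ n → I n = ⊥ := by
  have : IsArtinianRing (Unitization F A) := IsArtinianRing.of_finite F _
  refine ⟨fun n => ((Ring.jacobson (Unitization F A) ^ n).restrictScalars F).comap
    (Unitization.inrHom F F A), ?_, ?_, ?_, ?_⟩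
  · ext; simp [Submodule.pow_zero]
  · intro x hx
    simpa [Submodule.pow_one] using inr_mem_jacobson hx
  · intro m n a b ha hb
    simp only [Submodule.mem_comap, Submodule.restrictScalars_mem, Unitization.inrHom_apply,
      Unitization.inr_mul] at ha hb ⊢
    rw [Ideal.IsTwoSided.pow_add]
    exact Ideal.mul_mem_mul ha hb
  · obtain ⟨N, hN⟩ := IsSemiprimaryRing.isNilpotent (R := Unitization F A)
    refine ⟨N, fun n hn => ?_⟩
    rw [eq_bot_iff]
    intro x hx
    simp only [Submodule.mem_comap, Submodule.restrictScalars_mem, Unitization.inrHom_apply] at hx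
    replace hx := Ideal.pow_le_pow_right hn hx
    rw [hN] at hx
    exact Unitization.inr_injective (R := F) hx

/-- The trace form of the left regular representation cuts out the Jacobson radical. -/
theorem mem_jacobsonRadical_iff_trace [FiniteDimensional F A]
    (hchar : ringChar F = 0 ∨ Module.finrank F A < ringChar F) {x : A} :
    x ∈ jacobsonRadical F A ↔
      ∀ a, LinearMap.trace F A (LinearMap.mulLeft F (a * x)) = 0 := by
  constructor
  · intro hx a
    obtain ⟨I, h0, h1, hmul, N, hN⟩ := exists_filtration F A
    refine (LinearMap.isNilpotent_trace_of_isNilpotent ⟨N, ?_⟩).eq_zero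
    have h : ∀ n z, (LinearMap.mulLeft F (a * x) ^ n) z ∈ I n := by
      intro n
      induction n with
      | zero => intro z; rw [h0]; trivial
      | succ n ih =>
        intro z
        rw [pow_succ', add_comm]
        exact hmul _ _ _ _ (h1 (mul_mem_jacobsonRadical_left a hx)) (ih z)
    ext z
    simpa [hN N le_rfl] using h N z
  · intro hx a
    -- Powers of `a * x` stay in `A * x`, so the hypothesis controls the traces of all powers.
    have hpow : ∀ n, ∃ b, LinearMap.mulLeft F (a * x) ^ (n + 1) = LinearMap.mulLeft F (b * x) := by
      intro n
      induction n with
      | zero => exact ⟨a, by simp⟩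
      | succ n ih =>
        obtain ⟨b, hb⟩ := ih
        refine ⟨b * x * a, ?_⟩
        rw [pow_succ, hb]
        ext z
        simp [mul_assoc]
    obtain ⟨n, hn⟩ := isNilpotent_of_forall_trace_pow_eq_zero hchar (LinearMap.mulLeft F (a * x))
      (fun n => by obtain ⟨b, hb⟩ := hpow n; rw [hb, hx])
    rw [isQuasiregular_iff_isUnit' F]
    -- One extra factor: `(a * x) ^ (n + 1)` is the zero map `L_{ax} ^ n` evaluated at `a * x`.
    refine IsNilpotent.isUnit_one_add ⟨n + 1, ?_⟩
    have h : ∀ k (z : A), ((a * x : A) : Unitization F A) ^ k * (z : Unitization F A)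
        = (((LinearMap.mulLeft F (a * x) ^ k) z : A) : Unitization F A) := by
      intro k
      induction k with
      | zero => simp
      | succ k ih => intro z; rw [pow_succ', pow_succ', mul_assoc, ih]; simp [mul_assoc]
    rw [pow_succ, h, hn]
    simp

end Nilpotency

/-! ### Subalgebras complementary to the radical. -/

section Complement

variable {F : Type*} [Field F] {A : Type*} [NonUnitalRing A] [Module F A]
  [IsScalarTower F A A] [SMulCommClass F A A]

/-- If `1 + c` is the inverse of `1 + x`, then `1 + x + y = (1 + x) * (1 + (1 + c) * y)`. -/
theorem isQuasiregular_add_mem_jacobsonRadical {x y : A} (hx : IsQuasiregular x)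
    (hy : y ∈ jacobsonRadical F A) : IsQuasiregular (x + y) := by
  obtain ⟨c, hc1, hc2⟩ := isQuasiregular_iff.mp hx
  have h1 := isQuasiregular_iff'.mp hx
  have h2 := isQuasiregular_iff'.mp (isQuasiregular_of_mem_jacobsonRadical
    (add_mem hy (mul_mem_jacobsonRadical_left c hy)))
  rw [isQuasiregular_iff']
  convert h1.mul h2 using 1
  apply PreQuasiregular.equiv.symm.injective
  simp only [PreQuasiregular.equiv_symm_apply, PreQuasiregular.val_mul,
    PreQuasiregular.equiv_apply_val]
  have e : y + c * y + x + x * (y + c * y) = x + y + (c + x + x * c) * y := by noncomm_ring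
  rw [e, hc1, zero_mul, add_zero]

/-- Quasi-regularity descends to finite dimensional subalgebras. -/
theorem isQuasiregular_of_coe [FiniteDimensional F A] (D : NonUnitalSubalgebra F A) {u : D}
    (hu : IsQuasiregular (u : A)) : IsQuasiregular u := by
  obtain ⟨v, hv1, hv2⟩ := isQuasiregular_iff.mp hu
  -- `1 + u` acts injectively on `A`, hence bijectively on the finite dimensional `D`. So `z + u * z
  -- = -u` is solvable in `D`, and injectivity on `A` identifies the solution with `v`.
  let T : D →ₗ[F] D := LinearMap.id + LinearMap.mulLeft F u
  have hinj : ∀ z : A, z + (u : A) * z = 0 → z = 0 := by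
    intro z hz
    have e : z + (u : A) * z + v * (z + (u : A) * z) = z + (u + v + v * u) * z := by noncomm_ring
    rw [hv2, hz] at e
    simpa using e.symm
  have hT : Function.Injective T := by
    rw [← LinearMap.ker_eq_bot, LinearMap.ker_eq_bot']
    intro z hz
    have : FiniteDimensional F D := inferInstanceAs (FiniteDimensional F D.toSubmodule)
    exact Subtype.ext (hinj z (congrArg Subtype.val hz))
  have : FiniteDimensional F D := inferInstanceAs (FiniteDimensional F D.toSubmodule)
  obtain ⟨z, hz⟩ := (LinearMap.injective_iff_surjective.mp hT) (-u)
  have hz' : (z : A) + u * z = -u := congrArg Subtype.val hz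
  have hzv : (z : A) = v := by
    refine sub_eq_zero.mp (hinj _ ?_)
    have e : (z : A) - v + u * (z - v) = (z + u * z) + u - (v + u + u * v) := by noncomm_ring
    rw [e, hz', hv1]; simp
  refine isQuasiregular_iff.mpr ⟨z, Subtype.ext ?_, Subtype.ext ?_⟩
  · simpa [hzv] using hv1
  · simpa [hzv] using hv2

/-- A subalgebra complementary to the Jacobson radical is a maximal semisimple subalgebra. -/
theorem maximal_isSemisimpleAlgebra_of_isCompl [FiniteDimensional F A]
    (B : NonUnitalSubalgebra F A) (hB : IsCompl B.toSubmodule (jacobsonRadical F A)) :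
    Maximal (fun C : NonUnitalSubalgebra F A => IsSemisimpleAlgebra F C) B := by
  have hsplit : ∀ a : A, ∃ b ∈ B, ∃ j ∈ jacobsonRadical F A, b + j = a := fun a =>
    Submodule.mem_sup.mp (hB.sup_eq_top ▸ Submodule.mem_top)
  refine ⟨?_, ?_⟩
  · refine (Submodule.eq_bot_iff _).mpr fun x hx => ?_
    have hxJ : (x : A) ∈ jacobsonRadical F A := by
      intro a
      obtain ⟨b, hb, j, hj, rfl⟩ := hsplit a
      rw [add_mul]
      exact isQuasiregular_add_mem_jacobsonRadical
        ((hx ⟨b, hb⟩).map (NonUnitalSubalgebraClass.subtype B))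
        (mul_mem_jacobsonRadical_right _ hj)
    exact Subtype.ext (Submodule.disjoint_def.mp hB.disjoint _ x.2 hxJ)
  · intro D hD hBD d hd
    obtain ⟨b, hb, j, hj, rfl⟩ := hsplit d
    -- Modular law: `D = B ⊕ (D ∩ J(A))`, and the second summand lies in `J(D) = 0`.
    have hjD : j ∈ D := by simpa using sub_mem hd (hBD hb)
    have h0 : (⟨j, hjD⟩ : D) ∈ jacobsonRadical F D := fun c =>
      isQuasiregular_of_coe D (hj c)
    rw [show jacobsonRadical F D = ⊥ from hD] at h0
    have : j = 0 := congrArg Subtype.val h0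
    rwa [this, add_zero]

end Complement

/-! ### Homogeneous projections. -/

section Projections

variable {F : Type*} [Field F] {V : Type*} [AddCommGroup V] [Module F V] {G : Type*}

/-- `p` is the family of projections onto the components of the decomposition `𝒱`, whose support
is contained in the finite set `S`. -/
structure IsProjectionFamily (𝒱 : G → Submodule F V) (S : Finset G) (p : G → V →ₗ[F] V) :
    Prop where
  mem : ∀ g x, p g x ∈ 𝒱 g
  eq_self : ∀ g, ∀ x ∈ 𝒱 g, p g x = x
  eq_zero : ∀ g h, h ≠ g → ∀ x ∈ 𝒱 h, p g x = 0
  sum_eq : ∀ x, ∑ g ∈ S, p g x = x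

theorem exists_isProjectionFamily [DecidableEq G] [FiniteDimensional F V]
    {𝒱 : G → Submodule F V} (h : DirectSum.IsInternal 𝒱) :
    ∃ S p, IsProjectionFamily 𝒱 S p := by
  let _ := h.chooseDecomposition
  have hfin : {g | 𝒱 g ≠ ⊥}.Finite :=
    WellFoundedGT.finite_ne_bot_of_iSupIndep h.submodule_iSupIndep
  refine ⟨hfin.toFinset, fun g => (𝒱 g).subtype ∘ₗ DirectSum.component F G (fun g => 𝒱 g) g ∘ₗ
    (DirectSum.decomposeLinearEquiv 𝒱).toLinearMap, ⟨fun g x => Subtype.property _, ?_, ?_, ?_⟩⟩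
  · intro g x hx
    exact DirectSum.decompose_of_mem_same 𝒱 hx
  · intro g k hk x hx
    exact DirectSum.decompose_of_mem_ne 𝒱 hx hk
  · intro x
    classical
    conv_rhs => rw [← DirectSum.sum_support_decompose 𝒱 x]
    symm
    refine Finset.sum_subset ?_ ?_
    · intro g hg
      have hne := DFinsupp.mem_support_iff.mp hg
      simp only [Set.Finite.mem_toFinset, Set.mem_ofPred_eq]
      intro hbot
      apply hne
      ext
      simpa [hbot] using (DirectSum.decompose 𝒱 x g).2
    · intro g _ hg
      simpa using hg

namespace IsProjectionFamily

variable {𝒱 : G → Submodule F V} {S : Finset G} {p : G → V →ₗ[F] V}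

theorem induction (hp : IsProjectionFamily 𝒱 S p) {P : V → Prop} (add : ∀ x y, P x → P y → P (x + y)) (zero : P 0)
    (hom : ∀ g, ∀ x ∈ 𝒱 g, P x) (x : V) :
    P x := by
  rw [← hp.sum_eq x]
  exact Finset.sum_induction _ _ add zero fun g _ => hom g _ (hp.mem g x)

theorem mem_of_ne_zero (hp : IsProjectionFamily 𝒱 S p) {g : G} {x : V} (hx : x ∈ 𝒱 g) (hx0 : x ≠ 0) : g ∈ S := by
  by_contra hg
  apply hx0
  rw [← hp.sum_eq x]
  exact Finset.sum_eq_zero fun k hk => hp.eq_zero k g (by rintro rfl; exact hg hk) x hx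

theorem tensor_ext (hp : IsProjectionFamily 𝒱 S p) {W U : Type*} [AddCommGroup W] [Module F W] [AddCommGroup U] [Module F U]
    {𝒲 : G → Submodule F W} {S' : Finset G} {q : G → W →ₗ[F] W}
    (hq : IsProjectionFamily 𝒲 S' q) {φ ψ : V ⊗[F] W →ₗ[F] U}
    (h : ∀ g k, ∀ x ∈ 𝒱 g, ∀ y ∈ 𝒲 k, φ (x ⊗ₜ y) = ψ (x ⊗ₜ y)) : φ = ψ := by
  refine TensorProduct.ext' fun x y => ?_
  refine hp.induction (P := fun x => φ (x ⊗ₜ y) = ψ (x ⊗ₜ y)) ?_ (by simp) ?_ x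
  · intro x x' hx hx'
    rw [TensorProduct.add_tmul, map_add, map_add, hx, hx']
  · intro g x hx
    refine hq.induction (P := fun y => φ (x ⊗ₜ y) = ψ (x ⊗ₜ y)) ?_ (by simp) ?_ y
    · intro y y' hy hy'
      rw [TensorProduct.tmul_add, map_add, map_add, hy, hy']
    · intro k y hy
      exact h g k x hx y hy

theorem isGradedSubspace {A : Type*} [NonUnitalRing A] [Module F A] {𝒜 : G → Submodule F A} {S : Finset G} {p : G → A →ₗ[F] A}
    (hp : IsProjectionFamily 𝒜 S p) {W : Submodule F A} (h : ∀ g, ∀ x ∈ W, p g x ∈ W) :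
    IsGradedSubspace 𝒜 W := by
  refine le_antisymm (fun x hx => ?_) (iSup_le fun g => inf_le_left)
  rw [← hp.sum_eq x]
  exact sum_mem fun g _ => Submodule.mem_iSup_of_mem g ⟨h g x hx, hp.mem g x⟩

end IsProjectionFamily

end Projections

/-! ### The radical is graded. -/

section GradedRadical

variable {F : Type*} [Field F] {A : Type*} [NonUnitalRing A] [Module F A]
  [IsScalarTower F A A] [SMulCommClass F A A] [FiniteDimensional F A]
  {G : Type*} [Group G] [DecidableEq G] {𝒜 : G → Submodule F A}

theorem trace_mulLeft_eq_zero (h𝒜 : IsGroupGrading 𝒜) {k : G} (hk : k ≠ 1) {c : A}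
    (hc : c ∈ 𝒜 k) : LinearMap.trace F A (LinearMap.mulLeft F c) = 0 :=
  LinearMap.trace_eq_zero_of_mapsTo_ne h𝒜.isInternal (fun i => k * i)
    (fun i => by simpa using hk) fun _ _ hx => h𝒜.mul_mem hc hx

/-- Homogeneous components of elements of the Jacobson radical lie in the Jacobson radical. -/
theorem proj_mem_jacobsonRadical (h𝒜 : IsGroupGrading 𝒜)
    (hchar : ringChar F = 0 ∨ Module.finrank F A < ringChar F) {S : Finset G}
    {p : G → A →ₗ[F] A} (hp : IsProjectionFamily 𝒜 S p) (g : G) {x : A}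
    (hx : x ∈ jacobsonRadical F A) : p g x ∈ jacobsonRadical F A := by
  rw [mem_jacobsonRadical_iff_trace hchar] at hx ⊢
  let τ : A →ₗ[F] F := LinearMap.trace F A ∘ₗ LinearMap.mul F A
  change ∀ a, τ (a * x) = 0 at hx
  change ∀ a, τ (a * p g x) = 0
  have hτ : ∀ k, k ≠ 1 → ∀ c ∈ 𝒜 k, τ c = 0 := fun k hk c hc => trace_mulLeft_eq_zero h𝒜 hk hc
  refine hp.induction ?_ (by simp) ?_
  · intro a b ha hb
    rw [add_mul, map_add, ha, hb, add_zero]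
  · intro h a ha
    -- If `h * g = 1`, the other components of `x` contribute degrees `≠ 1` and hence trace zero, so
    -- `τ (a * x) = τ (a * p g x)`. Otherwise `a * p g x` itself has degree `≠ 1`.
    by_cases hg : h * g = 1
    · have h0 := hx a
      rw [← hp.sum_eq x, Finset.mul_sum, map_sum] at h0
      by_cases hgS : g ∈ S
      · rwa [Finset.sum_eq_single_of_mem g hgS] at h0
        intro k _ hk
        refine hτ (h * k) (fun e => hk ?_) _ (h𝒜.mul_mem ha (hp.mem k x))
        exact mul_left_cancel (e.trans hg.symm)
      · have : p g x = 0 := by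
          by_contra hne
          exact hgS (hp.mem_of_ne_zero (hp.mem g x) hne)
        rw [this, mul_zero, map_zero]
    · exact hτ _ hg _ (h𝒜.mul_mem ha (hp.mem g x))

end GradedRadical

/-! ### Separability elements of degree one. -/

section Separability

variable {F : Type*} [Field F] {C : Type*} [NonUnitalRing C] [Module F C]
  [IsScalarTower F C C] [SMulCommClass F C C] {G : Type*} [Group G]

/-- The component of degree one of the tensor square of a graded algebra. -/
def tensorDegreeOne (𝒞 : G → Submodule F C) : Submodule F (C ⊗[F] C) :=
  Submodule.span F {z | ∃ g, ∃ x ∈ 𝒞 g, ∃ y ∈ 𝒞 g⁻¹, z = x ⊗ₜ y}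

/-- The projection onto the component of degree `k` of the tensor square. -/
def tensorProj [DecidableEq G] (S : Finset G) (q : G → C →ₗ[F] C) (k : G) :
    C ⊗[F] C →ₗ[F] C ⊗[F] C :=
  ∑ g ∈ S, ∑ h ∈ S, if g * h = k then TensorProduct.map (q g) (q h) else 0

variable {𝒞 : G → Submodule F C} {S : Finset G} {q : G → C →ₗ[F] C}

theorem tensorProj_tmul [DecidableEq G] (hq : IsProjectionFamily 𝒞 S q) (k : G) {g h : G}
    {x y : C} (hx : x ∈ 𝒞 g) (hy : y ∈ 𝒞 h) :
    tensorProj S q k (x ⊗ₜ y) = if g * h = k then x ⊗ₜ y else 0 := by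
  by_cases hx0 : x = 0
  · simp [hx0]
  by_cases hy0 : y = 0
  · simp [hy0]
  simp only [tensorProj, LinearMap.sum_apply]
  rw [Finset.sum_eq_single_of_mem g (hq.mem_of_ne_zero hx hx0),
    Finset.sum_eq_single_of_mem h (hq.mem_of_ne_zero hy hy0)]
  · split_ifs
    · rw [TensorProduct.map_tmul, hq.eq_self g x hx, hq.eq_self h y hy]
    · rfl
  · intro l _ hl
    split_ifs
    · rw [TensorProduct.map_tmul, hq.eq_zero l h hl.symm y hy, TensorProduct.tmul_zero]
    · rfl
  · intro l _ hl
    refine Finset.sum_eq_zero fun m _ => ?_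
    split_ifs
    · rw [TensorProduct.map_tmul, hq.eq_zero l g hl.symm x hx, TensorProduct.zero_tmul]
    · rfl

theorem tensorProj_one_mem [DecidableEq G] (hq : IsProjectionFamily 𝒞 S q) (z : C ⊗[F] C) :
    tensorProj S q 1 z ∈ tensorDegreeOne 𝒞 := by
  have h : (tensorDegreeOne 𝒞).mkQ ∘ₗ tensorProj S q 1 = 0 := by
    refine hq.tensor_ext hq fun g k x hx y hy => ?_
    rw [LinearMap.comp_apply, tensorProj_tmul hq 1 hx hy]
    split_ifs with hgk
    · refine (Submodule.Quotient.mk_eq_zero _).mpr (Submodule.subset_span ⟨g, x, hx, y, ?_, rfl⟩)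
      rwa [← eq_inv_of_mul_eq_one_right hgk]
    · simp
  exact (Submodule.Quotient.mk_eq_zero _).mp (LinearMap.congr_fun h z)

theorem mul'_mem_of_mem_tensorDegreeOne
    (hmul : ∀ {g h : G} {a b : C}, a ∈ 𝒞 g → b ∈ 𝒞 h → a * b ∈ 𝒞 (g * h)) {z : C ⊗[F] C}
    (hz : z ∈ tensorDegreeOne 𝒞) : LinearMap.mul' F C z ∈ 𝒞 1 := by
  refine (Submodule.span_le (p := (𝒞 1).comap (LinearMap.mul' F C))).mpr ?_ hz
  rintro _ ⟨g, x, hx, y, hy, rfl⟩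
  simpa using hmul hx hy

theorem proj_mul_of_mem (hq : IsProjectionFamily 𝒞 S q)
    (hmul : ∀ {g h : G} {a b : C}, a ∈ 𝒞 g → b ∈ 𝒞 h → a * b ∈ 𝒞 (g * h)) (g k : G) (x : C)
    {c : C} (hc : c ∈ 𝒞 k) : q (g * k) (x * c) = q g x * c := by
  refine hq.induction (P := fun x => q (g * k) (x * c) = q g x * c) ?_ (by simp) ?_ x
  · intro x y hx hy
    rw [add_mul, map_add, map_add, hx, hy, add_mul]
  · intro h x hx
    by_cases hg : h = g
    · subst hg
      rw [hq.eq_self _ _ (hmul hx hc), hq.eq_self _ _ hx]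
    · rw [hq.eq_zero _ _ (by simpa using hg) _ (hmul hx hc), hq.eq_zero _ _ hg _ hx, zero_mul]

theorem proj_mul_of_mem_left (hq : IsProjectionFamily 𝒞 S q)
    (hmul : ∀ {g h : G} {a b : C}, a ∈ 𝒞 g → b ∈ 𝒞 h → a * b ∈ 𝒞 (g * h)) (g k : G) (x : C)
    {c : C} (hc : c ∈ 𝒞 k) : q (k * g) (c * x) = c * q g x := by
  refine hq.induction (P := fun x => q (k * g) (c * x) = c * q g x) ?_ (by simp) ?_ x
  · intro x y hx hy
    rw [mul_add, map_add, map_add, hx, hy, mul_add]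
  · intro h x hx
    by_cases hg : h = g
    · subst hg
      rw [hq.eq_self _ _ (hmul hc hx), hq.eq_self _ _ hx]
    · rw [hq.eq_zero _ _ (by simpa using hg) _ (hmul hc hx), hq.eq_zero _ _ hg _ hx, mul_zero]

/-- A graded separable algebra has a separability element of degree one. -/
theorem exists_separabilityElement_degreeOne [DecidableEq G] (hq : IsProjectionFamily 𝒞 S q)
    (hmul : ∀ {g h : G} {a b : C}, a ∈ 𝒞 g → b ∈ 𝒞 h → a * b ∈ 𝒞 (g * h))
    (hsep : IsSeparableAlgebra F C) :
    ∃ e ∈ tensorDegreeOne 𝒞,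
      (∀ a : C, TensorProduct.map (LinearMap.mulLeft F a) LinearMap.id e =
        TensorProduct.map LinearMap.id (LinearMap.mulRight F a) e) ∧
      ∀ a : C, LinearMap.mul' F C e * a = a ∧ a * LinearMap.mul' F C e = a := by
  obtain ⟨e, he, hone⟩ := hsep
  refine ⟨tensorProj S q 1 e, tensorProj_one_mem hq e, ?_, ?_⟩
  · refine hq.induction ?_ (by simp) ?_
    · intro a b ha hb
      have hl : LinearMap.mulLeft F (a + b) = LinearMap.mulLeft F a + LinearMap.mulLeft F b := by
        ext; simp [add_mul]
      have hr : LinearMap.mulRight F (a + b) = LinearMap.mulRight F a + LinearMap.mulRight F b := by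
        ext; simp [mul_add]
      rw [hl, hr, TensorProduct.map_add_left, TensorProduct.map_add_right, LinearMap.add_apply,
        LinearMap.add_apply, ha, hb]
    · intro k a ha
      -- Left multiplication by `a` changes total degree `d` to `k * d`, right multiplication to `d
      -- * k`; each takes degree one, and no other degree, to degree `k`.
      have h1 : TensorProduct.map (LinearMap.mulLeft F a) LinearMap.id ∘ₗ tensorProj S q 1
          = tensorProj S q k ∘ₗ TensorProduct.map (LinearMap.mulLeft F a) LinearMap.id := by
        refine hq.tensor_ext hq fun g h x hx y hy => ?_
        simp only [LinearMap.comp_apply, TensorProduct.map_tmul, LinearMap.mulLeft_apply,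
          LinearMap.id_apply, tensorProj_tmul hq _ hx hy, tensorProj_tmul hq _ (hmul ha hx) hy,
          mul_assoc, mul_eq_left]
        split_ifs <;> simp
      have h2 : TensorProduct.map LinearMap.id (LinearMap.mulRight F a) ∘ₗ tensorProj S q 1
          = tensorProj S q k ∘ₗ TensorProduct.map LinearMap.id (LinearMap.mulRight F a) := by
        refine hq.tensor_ext hq fun g h x hx y hy => ?_
        simp only [LinearMap.comp_apply, TensorProduct.map_tmul, LinearMap.mulRight_apply,
          LinearMap.id_apply, tensorProj_tmul hq _ hx hy, tensorProj_tmul hq _ hx (hmul hy ha),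
          ← mul_assoc, mul_eq_right]
        split_ifs <;> simp
      rw [← LinearMap.comp_apply, h1, ← LinearMap.comp_apply _ (tensorProj S q 1), h2,
        LinearMap.comp_apply, LinearMap.comp_apply, he]
  · have hμ : LinearMap.mul' F C (tensorProj S q 1 e) = q 1 (LinearMap.mul' F C e) := by
      have h : LinearMap.mul' F C ∘ₗ tensorProj S q 1 = q 1 ∘ₗ LinearMap.mul' F C := by
        refine hq.tensor_ext hq fun g h x hx y hy => ?_
        rw [LinearMap.comp_apply, LinearMap.comp_apply, tensorProj_tmul hq 1 hx hy]
        split_ifs with hgh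
        · rw [LinearMap.mul'_apply, hq.eq_self]
          exact hgh ▸ hmul hx hy
        · rw [LinearMap.mul'_apply, map_zero, hq.eq_zero _ _ hgh _ (hmul hx hy)]
      exact LinearMap.congr_fun h e
    rw [hμ]
    refine hq.induction ?_ (by simp) ?_
    · rintro a b ⟨ha, ha'⟩ ⟨hb, hb'⟩
      rw [mul_add, add_mul, ha, ha', hb, hb']
      exact ⟨rfl, rfl⟩
    · intro k a ha
      have h1 := proj_mul_of_mem hq hmul 1 k (LinearMap.mul' F C e) ha
      have h2 := proj_mul_of_mem_left hq hmul 1 k (LinearMap.mul' F C e) ha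
      rw [one_mul, (hone a).1, hq.eq_self k a ha] at h1
      rw [mul_one, (hone a).2, hq.eq_self k a ha] at h2
      exact ⟨h1.symm, h2.symm⟩

end Separability

/-! ### Newton iteration for multiplicative sections. -/

section Lifting

variable {F : Type*} [Field F] {A : Type*} [NonUnitalRing A] [Module F A]
  [IsScalarTower F A A] [SMulCommClass F A A] {C : Type*} [NonUnitalRing C] [Module F C]
  [IsScalarTower F C C] [SMulCommClass F C C]

/-- The map `x ⊗ y ↦ (b ↦ s x * (s y * s b - s (y * b)))`, contracting the failure of
multiplicativity of `s`. -/
def contraction (s : C →ₗ[F] A) : C ⊗[F] C →ₗ[F] C →ₗ[F] A :=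
  TensorProduct.lift (LinearMap.mk₂ F
    (fun x y => LinearMap.mulLeft F (s x) ∘ₗ
      (LinearMap.mulLeft F (s y) ∘ₗ s - s ∘ₗ LinearMap.mulLeft F y))
    (fun x x' y => by ext; simp [add_mul])
    (fun r x y => by ext; simp [smul_mul_assoc])
    (fun x y y' => by ext; simp [add_mul]; noncomm_ring)
    (fun r x y => by ext; simp [smul_sub, mul_sub, smul_mul_assoc, mul_smul_comm]))

theorem contraction_tmul (s : C →ₗ[F] A) (x y b : C) :
    contraction s (x ⊗ₜ y) b = s x * (s y * s b - s (y * b)) := rfl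

theorem contraction_mem {I : ℕ → Submodule F A} (h0 : I 0 = ⊤)
    (hI : ∀ m n a b, a ∈ I m → b ∈ I n → a * b ∈ I (m + n)) {s : C →ₗ[F] A} {n : ℕ}
    (hf : ∀ a b, s a * s b - s (a * b) ∈ I n) (z : C ⊗[F] C) (b : C) :
    contraction s z b ∈ I n := by
  induction z with
  | zero => simp
  | add z w hz hw => rw [map_add, LinearMap.add_apply]; exact add_mem hz hw
  | tmul x y =>
    rw [contraction_tmul]
    exact zero_add n ▸ hI 0 n _ _ (h0 ▸ Submodule.mem_top) (hf y b)

/-- On `x ⊗ y` the difference is a product of two defects, of `(a, x)` and of `(y, b)`; hence the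
doubled depth. -/
theorem mul_contraction_sub_mem {I : ℕ → Submodule F A}
    (hI : ∀ m n a b, a ∈ I m → b ∈ I n → a * b ∈ I (m + n)) {s : C →ₗ[F] A} {n : ℕ}
    (hf : ∀ a b, s a * s b - s (a * b) ∈ I n) (a : C) (z : C ⊗[F] C) (b : C) :
    s a * contraction s z b
      - contraction s (TensorProduct.map (LinearMap.mulLeft F a) LinearMap.id z) b
      ∈ I (n + n) := by
  induction z with
  | zero => simp
  | add z w hz hw =>
    convert add_mem hz hw using 1
    simp only [map_add, LinearMap.add_apply, mul_add]
    abel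
  | tmul x y =>
    convert hI n n _ _ (hf a x) (hf y b) using 1
    simp only [TensorProduct.map_tmul, LinearMap.mulLeft_apply, LinearMap.id_apply,
      contraction_tmul]
    noncomm_ring

/-- The cocycle identity, contracted. -/
theorem contraction_cocycle (s : C →ₗ[F] A) (z : C ⊗[F] C) (a b : C) :
    contraction s (TensorProduct.map LinearMap.id (LinearMap.mulRight F a) z) b
      - contraction s z (a * b) + contraction s z a * s b
      = LinearMap.mul' F A (TensorProduct.map s s z) * (s a * s b - s (a * b)) := by
  induction z with
  | zero => simp
  | add z w hz hw =>
    simp only [map_add, LinearMap.add_apply, add_mul]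
    rw [← hz, ← hw]
    abel
  | tmul x y =>
    simp only [TensorProduct.map_tmul, LinearMap.mulRight_apply, LinearMap.id_apply,
      contraction_tmul, LinearMap.mul'_apply, mul_assoc y a b]
    noncomm_ring

theorem mul'_map_sub_mem {I : ℕ → Submodule F A} {s : C →ₗ[F] A} {n : ℕ}
    (hf : ∀ a b, s a * s b - s (a * b) ∈ I n) (z : C ⊗[F] C) :
    LinearMap.mul' F A (TensorProduct.map s s z) - s (LinearMap.mul' F C z) ∈ I n := by
  induction z with
  | zero => simp
  | add z w hz hw =>
    convert add_mem hz hw using 1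
    simp only [map_add]
    abel
  | tmul x y => simpa using hf x y

theorem map_contraction {s : C →ₗ[F] A} {π : A →ₗ[F] C} (hπ : ∀ a b, π (a * b) = π a * π b)
    (hs : ∀ c, π (s c) = c) (z : C ⊗[F] C) (b : C) : π (contraction s z b) = 0 := by
  induction z with
  | zero => simp
  | add z w hz hw => rw [map_add, LinearMap.add_apply, map_add, hz, hw, add_zero]
  | tmul x y => rw [contraction_tmul]; simp [hπ, hs]

/-- The two legs of a degree-one tensor have inverse degrees, which cancel around the degree of `b`.
-/
theorem contraction_mem_component {G : Type*} [Group G] {𝒜 : G → Submodule F A}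
    {𝒞 : G → Submodule F C}
    (hA : ∀ {g h : G} {a b : A}, a ∈ 𝒜 g → b ∈ 𝒜 h → a * b ∈ 𝒜 (g * h))
    (hC : ∀ {g h : G} {a b : C}, a ∈ 𝒞 g → b ∈ 𝒞 h → a * b ∈ 𝒞 (g * h)) {s : C →ₗ[F] A}
    (hdeg : ∀ g, ∀ c ∈ 𝒞 g, s c ∈ 𝒜 g) {z : C ⊗[F] C} (hz : z ∈ tensorDegreeOne 𝒞) {k : G}
    {b : C} (hb : b ∈ 𝒞 k) : contraction s z b ∈ 𝒜 k := by
  refine (Submodule.span_le (p := (𝒜 k).comap ((contraction s).flip b))).mpr ?_ hz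
  rintro _ ⟨g, x, hx, y, hy, rfl⟩
  have h := hA (hdeg _ _ hx)
    (sub_mem (hA (hdeg _ _ hy) (hdeg _ _ hb)) (hdeg _ _ (hC hy hb)))
  rw [mul_inv_cancel_left] at h
  exact h

/-- The correction of a linear section by the contraction of its failure of multiplicativity with
`e`; here `u` is an identity element, which `s` need not send to an identity element. -/
def corrected (s : C →ₗ[F] A) (e : C ⊗[F] C) (u : C) : C →ₗ[F] A :=
  s - contraction s e + (LinearMap.id - LinearMap.mulLeft F (s u)) ∘ₗ
    (LinearMap.mulLeft F (s u) ∘ₗ s - s ∘ₗ LinearMap.mulLeft F u)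

theorem corrected_apply (s : C →ₗ[F] A) (e : C ⊗[F] C) (u c : C) :
    corrected s e u c = s c - contraction s e c +
      ((s u * s c - s (u * c)) - s u * (s u * s c - s (u * c))) := rfl

/-- Let `f` be the defect of `s`, `u` the identity of `C`, and `1` a formal identity of `A`. Work
modulo `I (n + n)`, where products of defects or corrections vanish. By the cocycle identity and the
centrality of `e`, subtracting `contraction s e` leaves the defect `(1 - s u) * f a b`. The further
term `(1 - s u) * f u c` contributes `-(1 - s u) ^ 2 * f a b`, because `s a * (1 - s u) * f u b =
-(f a u * f u b)` vanishes. The remainder `(1 - s u) * s u * f a b = -(f u u * f a b)` vanishes too.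
-/
theorem corrected_mul_sub_mem {I : ℕ → Submodule F A} (h0 : I 0 = ⊤)
    (hI : ∀ m n a b, a ∈ I m → b ∈ I n → a * b ∈ I (m + n)) {s : C →ₗ[F] A} {n : ℕ}
    (hf : ∀ a b, s a * s b - s (a * b) ∈ I n) {e : C ⊗[F] C}
    (he : ∀ a : C, TensorProduct.map (LinearMap.mulLeft F a) LinearMap.id e =
      TensorProduct.map LinearMap.id (LinearMap.mulRight F a) e)
    (hone : ∀ a : C, LinearMap.mul' F C e * a = a ∧ a * LinearMap.mul' F C e = a) (a b : C) :
    corrected s e (LinearMap.mul' F C e) a * corrected s e (LinearMap.mul' F C e) b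
      - corrected s e (LinearMap.mul' F C e) (a * b) ∈ I (n + n) := by
  have h1 := mul_contraction_sub_mem hI hf a e b
  have h2 := contraction_cocycle s e a b
  have h3 := hI n n _ _ (mul'_map_sub_mem hf e) (hf a b)
  have h4 : ∀ c, contraction s e c ∈ I n := contraction_mem h0 hI hf e
  rw [he a] at h1
  simp only [corrected_apply]
  set u := LinearMap.mul' F C e
  set m := LinearMap.mul' F A (TensorProduct.map s s e)
  set w := contraction s (TensorProduct.map LinearMap.id (LinearMap.mulRight F a) e) b
  set H := contraction s e
  have h5 := hI n n _ _ (hf a u) (hf u b)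
  have h6 := hI n n _ _ (hf u u) (hf a b)
  have h7 : ∀ c, (s u * s c - s (u * c)) - s u * (s u * s c - s (u * c)) - H c ∈ I n := fun c =>
    sub_mem (sub_mem (hf u c)
      (zero_add n ▸ hI 0 n _ _ (h0 ▸ Submodule.mem_top) (hf u c))) (h4 c)
  have h8 := hI n n _ _ (h7 a) (h7 b)
  simp only [(hone _).1, (hone _).2] at h5 h6 h8 ⊢
  have key := sub_mem (sub_mem (sub_mem (sub_mem h8 h1) h3) h5) h6
  convert key using 1
  rw [sub_mul m, ← h2]
  noncomm_ring

/-- A graded algebra surjection with kernel in a nilpotent filtration onto an algebra with a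
separability element of degree one has a graded multiplicative section. -/
theorem exists_multiplicative_section {G : Type*} [Group G] {𝒜 : G → Submodule F A}
    {𝒞 : G → Submodule F C}
    (hA : ∀ {g h : G} {a b : A}, a ∈ 𝒜 g → b ∈ 𝒜 h → a * b ∈ 𝒜 (g * h))
    (hC : ∀ {g h : G} {a b : C}, a ∈ 𝒞 g → b ∈ 𝒞 h → a * b ∈ 𝒞 (g * h))
    {π : A →ₗ[F] C} (hπ : ∀ a b, π (a * b) = π a * π b)
    {I : ℕ → Submodule F A} (h0 : I 0 = ⊤) (h1 : LinearMap.ker π ≤ I 1)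
    (hI : ∀ m n a b, a ∈ I m → b ∈ I n → a * b ∈ I (m + n)) {N : ℕ}
    (hN : ∀ n, N ≤ n → I n = ⊥) {e : C ⊗[F] C} (hdegree : e ∈ tensorDegreeOne 𝒞)
    (he : ∀ a : C, TensorProduct.map (LinearMap.mulLeft F a) LinearMap.id e =
      TensorProduct.map LinearMap.id (LinearMap.mulRight F a) e)
    (hone : ∀ a : C, LinearMap.mul' F C e * a = a ∧ a * LinearMap.mul' F C e = a)
    {s₀ : C →ₗ[F] A} (hs₀ : ∀ c, π (s₀ c) = c) (hdeg₀ : ∀ g, ∀ c ∈ 𝒞 g, s₀ c ∈ 𝒜 g) :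
    ∃ s : C →ₗ[F] A, (∀ c, π (s c) = c) ∧ (∀ g, ∀ c ∈ 𝒞 g, s c ∈ 𝒜 g) ∧
      ∀ a b, s (a * b) = s a * s b := by
  have step : ∀ n, ∃ s : C →ₗ[F] A, (∀ c, π (s c) = c) ∧ (∀ g, ∀ c ∈ 𝒞 g, s c ∈ 𝒜 g) ∧
      ∀ a b, s a * s b - s (a * b) ∈ I (2 ^ n) := by
    intro n
    induction n with
    | zero =>
      refine ⟨s₀, hs₀, hdeg₀, fun a b => h1 ?_⟩
      simp [hπ, hs₀]
    | succ n ih =>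
      obtain ⟨s, hs, hdeg, hf⟩ := ih
      have hu := mul'_mem_of_mem_tensorDegreeOne hC hdegree
      refine ⟨corrected s e (LinearMap.mul' F C e), fun c => ?_, fun g c hc => ?_, fun a b => ?_⟩
      · rw [corrected_apply, map_add, map_sub, map_contraction hπ hs]
        simp [hπ, hs]
      · have h2 : ∀ x ∈ 𝒜 g, s (LinearMap.mul' F C e) * x ∈ 𝒜 g := fun x hx => by
          simpa using hA (hdeg _ _ hu) hx
        have h3 := sub_mem (h2 _ (hdeg _ _ hc)) (hdeg _ _ (one_mul g ▸ hC hu hc))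
        rw [corrected_apply]
        exact add_mem (sub_mem (hdeg _ _ hc) (contraction_mem_component hA hC hdeg hdegree hc))
          (sub_mem h3 (h2 _ h3))
      · rw [pow_succ, mul_two]
        exact corrected_mul_sub_mem h0 hI hf he hone a b
  obtain ⟨s, hs, hdeg, hf⟩ := step N
  refine ⟨s, hs, hdeg, fun a b => ?_⟩
  have h := hf a b
  rw [hN _ (Nat.lt_two_pow_self).le, Submodule.mem_bot, sub_eq_zero] at h
  exact h.symm

end Lifting

end GradedWM

end

/-! ### The graded Wedderburn–Mal'cev theorem. -/

theorem mainTheorem6 {F : Type*} [Field F] {A : Type*} [NonUnitalRing A] [Module F A]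
    [IsScalarTower F A A] [SMulCommClass F A A] [FiniteDimensional F A]
    {G : Type*} [Group G] [DecidableEq G] (𝒜 : G → Submodule F A)
    (h𝒜 : GradedWM.IsGroupGrading 𝒜)
    (hchar : ringChar F = 0 ∨ Module.finrank F A < ringChar F)
    (hsep : GradedWM.IsSeparableAlgebra F (GradedWM.JacobsonQuotient F A)) :
    ∃ B : NonUnitalSubalgebra F A,
      Maximal (fun C : NonUnitalSubalgebra F A => GradedWM.IsSemisimpleAlgebra F C) B ∧
      GradedWM.IsGradedSubspace 𝒜 B.toSubmodule ∧
      GradedWM.IsGradedSubspace 𝒜 (GradedWM.jacobsonRadical F A) ∧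
      IsCompl B.toSubmodule (GradedWM.jacobsonRadical F A) := by
  open GradedWM in
  obtain ⟨S, p, hp⟩ := exists_isProjectionFamily h𝒜.isInternal
  have hJ : ∀ g, ∀ x ∈ jacobsonRadical F A, p g x ∈ jacobsonRadical F A := fun g x hx =>
    proj_mem_jacobsonRadical h𝒜 hchar hp g hx
  let π := JacobsonQuotient.mk F A
  have hker : LinearMap.ker π = jacobsonRadical F A := (jacobsonRadical F A).ker_mkQ
  let q : G → JacobsonQuotient F A →ₗ[F] JacobsonQuotient F A := fun g =>
    (jacobsonRadical F A).mapQ (jacobsonRadical F A) (p g) (hJ g)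
  have hqπ : ∀ g a, q g (π a) = π (p g a) := fun g a => rfl
  let 𝒞 : G → Submodule F (JacobsonQuotient F A) := fun g => (𝒜 g).map π
  have hq : IsProjectionFamily 𝒞 S q := by
    refine ⟨fun g x => ?_, ?_, ?_, fun x => ?_⟩
    · obtain ⟨a, rfl⟩ := JacobsonQuotient.mk_surjective F A x
      exact ⟨p g a, hp.mem g a, rfl⟩
    · rintro g _ ⟨a, ha, rfl⟩
      rw [hqπ, hp.eq_self g a ha]
    · rintro g h hne _ ⟨a, ha, rfl⟩
      rw [hqπ, hp.eq_zero g h hne a ha, map_zero]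
    · obtain ⟨a, rfl⟩ := JacobsonQuotient.mk_surjective F A x
      change ∑ g ∈ S, q g (π a) = π a
      simp only [hqπ, ← map_sum, hp.sum_eq]
  have hC : ∀ {g h : G} {a b : JacobsonQuotient F A}, a ∈ 𝒞 g → b ∈ 𝒞 h → a * b ∈ 𝒞 (g * h) := by
    rintro g h _ _ ⟨a, ha, rfl⟩ ⟨b, hb, rfl⟩
    exact ⟨a * b, h𝒜.mul_mem ha hb, JacobsonQuotient.mk_mul F A a b⟩
  obtain ⟨e, hdegree, he, hone⟩ := exists_separabilityElement_degreeOne hq hC hsep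
  obtain ⟨I, h0, h1, hI, N, hN⟩ := exists_filtration F A
  obtain ⟨t, ht⟩ := π.exists_rightInverse_of_surjective
    (LinearMap.range_eq_top.mpr (JacobsonQuotient.mk_surjective F A))
  replace ht : ∀ c, π (t c) = c := LinearMap.congr_fun ht
  obtain ⟨s, hs, hdeg, hmul⟩ := exists_multiplicative_section h𝒜.mul_mem hC
    (JacobsonQuotient.mk_mul F A) h0 (hker.trans_le h1) hI hN hdegree he hone
    -- The arbitrary section `t` is homogenized by keeping only its degree-preserving part; this is
    -- still a section because `π` commutes with the projections.
    (s₀ := ∑ g ∈ S, p g ∘ₗ t ∘ₗ q g)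
    (fun c => by
      simp only [LinearMap.sum_apply, LinearMap.comp_apply, map_sum]
      conv_rhs => rw [← hq.sum_eq c]
      refine Finset.sum_congr rfl fun g _ => ?_
      change π (p g (t (q g c))) = q g c
      rw [← hqπ, ht, hq.eq_self g _ (hq.mem g c)])
    (fun g c hc => by
      rw [LinearMap.sum_apply]
      refine sum_mem fun h _ => ?_
      by_cases hg : g = h
      · subst hg; exact hp.mem g _
      · rw [LinearMap.comp_apply, LinearMap.comp_apply, hq.eq_zero h g hg c hc, map_zero, map_zero]
        exact zero_mem _)
  replace hs : ∀ c, π (s c) = c := hs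
  let B : NonUnitalSubalgebra F A :=
    { LinearMap.range s with
      mul_mem' := by
        rintro _ _ ⟨a, rfl⟩ ⟨b, rfl⟩
        exact ⟨a * b, hmul a b⟩ }
  have hB : B.toSubmodule = LinearMap.range s := rfl
  have hcompl : IsCompl B.toSubmodule (jacobsonRadical F A) := by
    rw [hB, ← hker]
    refine ⟨Submodule.disjoint_def.mpr ?_, codisjoint_iff_le_sup.mpr fun a _ => ?_⟩
    · rintro _ ⟨c, rfl⟩ hc
      rw [LinearMap.mem_ker, hs] at hc
      rw [hc, map_zero]
    · refine Submodule.mem_sup.mpr ⟨s (π a), ⟨π a, rfl⟩, a - s (π a), ?_, add_sub_cancel _ _⟩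
      rw [LinearMap.mem_ker, map_sub, hs, sub_self]
  refine ⟨B, maximal_isSemisimpleAlgebra_of_isCompl B hcompl, ?_, hp.isGradedSubspace hJ, hcompl⟩
  refine le_antisymm ?_ (iSup_le fun g => inf_le_left)
  rintro _ ⟨c, rfl⟩
  rw [← hq.sum_eq c, map_sum]
  exact sum_mem fun g _ => Submodule.mem_iSup_of_mem g ⟨⟨q g c, rfl⟩, hdeg g _ (hq.mem g c)⟩
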